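/- **Theorem.** There is an absolute constant $p<1$ such that for every $\varepsilon>0$ the following holds: any (deterministic or randomized) algorithm that performs triangle enumeration in sparse hypergraphs in the PRIMAL CONGEST model with probability of success at least $p$ requires $\Omega(n^{1-\varepsilon})$ rounds. In detail: for all constants $\varepsilon, C, \beta>0$ there are $c>0$ and $n_0$ such that for all $n\ge n_0$ and all $B\le\beta\log n$, if an algorithm with $B$-bit messages enumerates, within $T$ rounds and with probability at least $p$, the triangles of each hypergraph $H=(V,E)$ with $V=\{0,\dots,n-1\}$ and $\sum_{e\in E}|e|\le Cn$, then $T\ge c\,n^{1-\varepsilon}$. *Model.* A hypergraph $H=(V,E)$ consists of a vertex set $V$ and a set $E$ of non-empty subsets of $V$, called edges. In PRIMAL CONGEST, every vertex initially knows $n$, its own ID (its name in $V$), its incident edges (each as the set of IDs of its vertices), and a random string, which may be shared by all vertices. In every synchronous round each vertex can send a separate message of $B$ bits to each vertex with which it shares an edge. Local computation is unrestricted, and the algorithm may depend on $n$. *Task.* A triangle of $H$ is a closed path $v_0,e_0,v_1,e_1,v_2,e_2$ with $e_i\in E$ and $v_i\in e_{i-1}\cap e_i$ (indices modulo $3$),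 considered up to the choice of starting vertex and direction. It is simple if $v_0,v_1,v_2$ are distinct and $e_0,e_1,e_2$ are distinct, and induced if it is simple and $v_i\notin e_{i+1}$ for all $i$. In triangle enumeration every vertex outputs a set of triangles of $H$ such that every triangle of $H$ is output by exactly one vertex. The bound holds for each of the three variants of the task in which "triangle" means any triangle, simple triangle, or induced triangle. -/

import Mathlib

namespace HyperCongest

/-! ## Hypergraphs and triangles -/

/-- `H` is a hypergraph whose vertex set is all of `V` and all of whose edges are non-empty. -/
def IsOn {V : Type} (H : Hypergraph V) : Prop :=
  H.vertexSet = Set.univ ∧ ∅ ∉ H.edgeSet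

/-- The total edge size `∑_{e ∈ E} |e|` (equivalently, the sum of the vertex degrees). It is only
used for a finite vertex type, where the sum is finite. -/
noncomputable def totalSize {V : Type} (H : Hypergraph V) : ℕ :=
  ∑ᶠ e ∈ H.edgeSet, e.ncard

/-- A cyclic sequence `v₀, e₀, v₁, e₁, v₂, e₂` of three vertices and three sets of vertices. -/
structure Cycle3 (V : Type) where
  vert : Fin 3 → V
  edge : Fin 3 → Set V

namespace Cycle3

variable {V : Type}

/-- `t` is a closed path of length three in `H`: its `eᵢ` are edges of `H`, and
`vᵢ ∈ eᵢ₋₁ ∩ eᵢ`, with indices modulo `3`. -/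
def IsIn (H : Hypergraph V) (t : Cycle3 V) : Prop :=
  (∀ i, t.edge i ∈ H.edgeSet) ∧ ∀ i, t.vert i ∈ t.edge (i - 1) ∧ t.vert i ∈ t.edge i

/-- The three vertices are distinct and the three edges are distinct. -/
def IsSimple (t : Cycle3 V) : Prop :=
  Function.Injective t.vert ∧ Function.Injective t.edge

/-- `t` is simple, and no vertex lies on the edge opposite to it. -/
def IsInduced (t : Cycle3 V) : Prop :=
  t.IsSimple ∧ ∀ i, t.vert i ∉ t.edge (i + 1)

/-- `t` and `t'` are the same cycle up to the choice of the starting vertex (first case) and of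
the direction in which the cycle is traversed (second case). -/
def Same (t t' : Cycle3 V) : Prop :=
  ∃ k : Fin 3,
    (∀ i, t'.vert i = t.vert (i + k) ∧ t'.edge i = t.edge (i + k)) ∨
    (∀ i, t'.vert i = t.vert (k - i) ∧ t'.edge i = t.edge (k - i - 1))

end Cycle3

/-- Which cycles of length three count as triangles: all of them, the simple ones, or the
induced ones. -/
inductive TriangleKind where
  | all
  | simple
  | induced

/-- `t` is a triangle (of the given kind) of the hypergraph `H`. -/
def IsTriangle {V : Type} (κ : TriangleKind) (H : Hypergraph V) (t : Cycle3 V) : Prop :=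
  t.IsIn H ∧
    match κ with
    | .all => True
    | .simple => t.IsSimple
    | .induced => t.IsInduced

/-- The family of outputs `S v`, one set for each vertex `v`, solves triangle enumeration on `H`:
only triangles of `H` are output, and every triangle of `H` is output by exactly one vertex. -/
def Enumerates {V : Type} (κ : TriangleKind) (H : Hypergraph V) (S : V → Set (Cycle3 V)) : Prop :=
  (∀ v, ∀ t ∈ S v, IsTriangle κ H t) ∧
    ∀ t, IsTriangle κ H t → ∃! v, ∃ t' ∈ S v, t.Same t'

/-! ## The PRIMAL CONGEST model -/

/-- What is sent over a link in one round: nothing, or a message of `B` bits. -/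
abbrev Message (B : ℕ) : Type := Option (Fin B → Bool)

/-- A synchronous algorithm for the vertex set `{0, …, n-1}`, for `B`-bit messages, using a random
string `ω : Ω`. Every vertex may see all of `ω`; private coins are the special case in which
each vertex uses only its own part of `ω`. Local computation is unrestricted. -/
structure Algorithm (n B : ℕ) (Ω : Type) where
  /-- The possible local states of a vertex. -/
  State : Type
  /-- The initial state of a vertex, from its ID, the list of its incident edges (each given as
  the set of the IDs of the vertices in it), and the random string. -/
  init : Fin n → Set (Set (Fin n)) → Ω → State
  /-- The message that a vertex in the given state addresses to each other vertex. -/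
  send : State → Fin n → Message B
  /-- The new state of a vertex, from its state and the messages received, listed by sender. -/
  step : State → (Fin n → Message B) → State
  /-- The set of triangles that a vertex in the given state outputs when it stops. -/
  output : State → Set (Cycle3 (Fin n))

namespace Algorithm

variable {n B : ℕ} {Ω : Type}

open Classical in
/-- The state of vertex `v` after the given number of rounds in the PRIMAL CONGEST model on `H`:
in each round, messages are delivered exactly between vertices that share an edge of `H`. -/
noncomputable def stateAfter (A : Algorithm n B Ω) (H : Hypergraph (Fin n)) (ω : Ω) :
    ℕ → Fin n → A.State
  | 0, v => A.init v {e | e ∈ H.edgeSet ∧ v ∈ e} ω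
  | t + 1, v => A.step (A.stateAfter H ω t v) fun u =>
      if H.Adj u v then A.send (A.stateAfter H ω t u) v else none

/-- On input `H` and random string `ω`, the outputs of the vertices after `T` rounds of PRIMAL
CONGEST enumerate the triangles of `H`. -/
def Correct (A : Algorithm n B Ω) (κ : TriangleKind) (T : ℕ) (H : Hypergraph (Fin n))
    (ω : Ω) : Prop :=
  Enumerates κ H fun v => A.output (A.stateAfter H ω T v)

/-- Within `T` rounds of PRIMAL CONGEST and with probability at least `p` over the random string
`ω ∼ μ`, the algorithm enumerates the triangles of `H`, for every hypergraph `H` with vertex set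
`{0, …, n-1}` and total edge size at most `C * n`. -/
def SolvesSparse [MeasurableSpace Ω] (A : Algorithm n B Ω) (μ : MeasureTheory.Measure Ω)
    (κ : TriangleKind) (C p : ℝ) (T : ℕ) : Prop :=
  ∀ H : Hypergraph (Fin n), IsOn H → (totalSize H : ℝ) ≤ C * n →
    MeasurableSet {ω | A.Correct κ T H ω} ∧ p ≤ μ.real {ω | A.Correct κ T H ω}

end Algorithm

end HyperCongest

namespace HyperCongest

/-! Take L indices for each of three edge types and let an independent bit choose one of two edges
per index. Any choice of one edge per type closes up to an induced triangle through three fixed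
corners, so there are at least L³ triangles of every kind. Each vertex is on no edge of some type,
and to output such a triangle it must name an edge of that type, hence a bit absent from its input.

Only m vertices are on edges at all. The others receive nothing, so they can share one player, and
among m + 1 players some player reveals at least ⌊L / (m + 1)⌋ unseen bits
(`exists_card_le_revealed`). It learns them from at most mT messages, and counting inputs
(`card_mul_two_pow_le`) gives L = O(m² (1 + (B + 1) T)). Averaging fixes a random string that is
good for half of all inputs.

Encoding an index as a function `Fin s → Fin k` and an edge as its graph gives L = k ^ s with m = 9
+ 3sk (`exists_gadget`). With L of order n, m is of order n^(1/s), and a large s yields the bound.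
-/

open Classical in
/-- The message that reaches `v` from `u` in round `t + 1`. -/
noncomputable def Algorithm.received {n B : ℕ} {Ω : Type} (A : Algorithm n B Ω)
    (H : Hypergraph (Fin n)) (ω : Ω) (t : ℕ) (v u : Fin n) : Message B :=
  if H.Adj u v then A.send (A.stateAfter H ω t u) v else none

theorem Algorithm.stateAfter_congr {n B : ℕ} {Ω : Type} (A : Algorithm n B Ω)
    {H H' : Hypergraph (Fin n)} {ω : Ω} {v : Fin n} {T : ℕ}
    (hinit : {e | e ∈ H.edgeSet ∧ v ∈ e} = {e | e ∈ H'.edgeSet ∧ v ∈ e})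
    (hmsg : ∀ t < T, ∀ u, A.received H ω t v u = A.received H' ω t v u) :
    A.stateAfter H ω T v = A.stateAfter H' ω T v := by
  induction T with
  | zero => simp only [Algorithm.stateAfter, hinit]
  | succ T ih =>
    have h₁ := ih fun t ht => hmsg t (by omega)
    have h₂ : A.received H ω T v = A.received H' ω T v := funext (hmsg T (by omega))
    change A.step _ (A.received H ω T v) = A.step _ (A.received H' ω T v)
    rw [h₁, h₂]

/-! ### Gadgets and their hypergraphs -/

/-- A family of potential edges of three types, indexed by `F`, where each index leaves the choice
between two edges. The edges of type `i` join `corner i` to `corner (i + 1)`, all edges live on the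
set `active`, and each vertex is on no edge of the type `missing v`. -/
structure Gadget (V F : Type) where
  edge : Fin 3 → F → Bool → Set V
  corner : Fin 3 → V
  active : Finset V
  missing : V → Fin 3
  edge_inj : ∀ {i f b i' f' b'}, edge i f b = edge i' f' b' → i = i' ∧ f = f' ∧ b = b'
  corner_mem : ∀ i f b, corner i ∈ edge i f b
  corner_mem_pred : ∀ i f b, corner i ∈ edge (i - 1) f b
  corner_notMem : ∀ i f b, corner i ∉ edge (i + 1) f b
  edge_subset : ∀ i f b, edge i f b ⊆ active
  notMem_edge_missing : ∀ v f b, v ∉ edge (missing v) f b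

namespace Gadget

/-- The hypergraph whose edges are selected by `x`. -/
def graph {V F : Type} (G : Gadget V F) (x : Fin 3 → F → Bool) : Hypergraph V where
  vertexSet := Set.univ
  edgeSet := Set.range fun p : Fin 3 × F => G.edge p.1 p.2 (x p.1 p.2)
  subset_vertexSet_of_mem_edgeSet' := fun _ _ => Set.subset_univ _

section Graph

variable {V F : Type} (G : Gadget V F)

theorem edge_mem_graph (x : Fin 3 → F → Bool) (i : Fin 3) (f : F) :
    G.edge i f (x i f) ∈ (G.graph x).edgeSet := ⟨(i, f), rfl⟩

theorem eq_of_edge_mem_graph {x : Fin 3 → F → Bool} {i : Fin 3} {f : F} {b : Bool}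
    (h : G.edge i f b ∈ (G.graph x).edgeSet) : x i f = b := by
  obtain ⟨⟨j, g⟩, h⟩ := h
  obtain ⟨rfl, rfl, rfl⟩ := G.edge_inj h
  rfl

theorem isOn_graph (x : Fin 3 → F → Bool) : IsOn (G.graph x) := by
  refine ⟨rfl, ?_⟩
  rintro ⟨⟨i, f⟩, h⟩
  have := G.corner_mem i f (x i f)
  simp only at h
  simp [h] at this

theorem totalSize_graph [Fintype F] (x : Fin 3 → F → Bool) {s : ℕ}
    (hs : ∀ i f b, (G.edge i f b).ncard ≤ s) :
    totalSize (G.graph x) ≤ 3 * Fintype.card F * s := by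
  have hinj : Function.Injective fun p : Fin 3 × F => G.edge p.1 p.2 (x p.1 p.2) := by
    rintro ⟨i, f⟩ ⟨j, g⟩ h
    obtain ⟨rfl, rfl, -⟩ := G.edge_inj h
    rfl
  unfold totalSize graph
  simp only
  rw [finsum_mem_range hinj, finsum_eq_sum_of_fintype]
  refine (Finset.sum_le_card_nsmul _ _ s fun p _ => hs _ _ _).trans ?_
  simp

/-- The triangle formed by one edge of each type. -/
def triangle (x : Fin 3 → F → Bool) (g : Fin 3 → F) : Cycle3 V where
  vert := G.corner
  edge := fun i => G.edge i (g i) (x i (g i))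

/-- These triangles are induced, so one construction serves all three kinds. -/
theorem isTriangle_triangle (κ : TriangleKind) (x : Fin 3 → F → Bool) (g : Fin 3 → F) :
    IsTriangle κ (G.graph x) (G.triangle x g) := by
  have hin : (G.triangle x g).IsIn (G.graph x) :=
    ⟨fun i => G.edge_mem_graph x i (g i), fun i => ⟨G.corner_mem_pred i _ _, G.corner_mem i _ _⟩⟩
  have hopp : ∀ i, (G.triangle x g).vert i ∉ (G.triangle x g).edge (i + 1) := fun i =>
    G.corner_notMem i _ _
  have hsimple : (G.triangle x g).IsSimple := by
    refine ⟨fun i j hij => ?_, fun i j hij => (G.edge_inj hij).1⟩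
    by_contra hne
    have h₁ := hopp i
    have h₂ := hopp j
    have h₃ : j = i + 1 ∨ i = j + 1 := by omega
    rcases h₃ with h | h
    · exact h₁ (hij ▸ h ▸ G.corner_mem j _ _)
    · exact h₂ (hij ▸ h ▸ G.corner_mem i _ _)
  refine ⟨hin, ?_⟩
  cases κ
  · trivial
  · exact hsimple
  · exact ⟨hsimple, hopp⟩

open Classical in
/-- All vertices outside `active` count as one player. -/
noncomputable def player (v : V) : Option V := if v ∈ G.active then some v else none

/-- A type of edges that are not incident to the given player. -/
def playerMissing : Option V → Fin 3
  | none => 0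
  | some v => G.missing v

theorem notMem_edge_playerMissing (v : V) (f : F) (b : Bool) :
    v ∉ G.edge (G.playerMissing (G.player v)) f b := by
  unfold player
  split_ifs with h
  · exact G.notMem_edge_missing v f b
  · exact fun hv => h (G.edge_subset _ _ _ hv)

theorem player_mem (v : V) : G.player v ∈ G.active.insertNone := by
  unfold player
  split_ifs with h <;> simp [h]

/-- A player is on no edge of its missing type, so its input carries no information about the bits
of that type. -/
theorem incident_congr {x x' : Fin 3 → F → Bool} {v : V}
    (h : ∀ j ≠ G.playerMissing (G.player v), x j = x' j) :
    {e | e ∈ (G.graph x).edgeSet ∧ v ∈ e} = {e | e ∈ (G.graph x').edgeSet ∧ v ∈ e} := by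
  have key : ∀ x x' : Fin 3 → F → Bool, (∀ j ≠ G.playerMissing (G.player v), x j = x' j) →
      {e | e ∈ (G.graph x).edgeSet ∧ v ∈ e} ⊆ {e | e ∈ (G.graph x').edgeSet ∧ v ∈ e} := by
    rintro x x' h e ⟨⟨⟨j, f⟩, rfl⟩, hv⟩
    have hj : j ≠ G.playerMissing (G.player v) := by
      rintro rfl
      exact G.notMem_edge_playerMissing v _ _ hv
    refine ⟨⟨(j, f), ?_⟩, hv⟩
    simp only [h j hj]
  exact (key x x' h).antisymm (key x' x fun j hj => (h j hj).symm)

end Graph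

/-! ### Information received by a player -/

section Counting

variable {n B : ℕ} {F Ω : Type} (G : Gadget (Fin n) F) (A : Algorithm n B Ω) (ω : Ω)

theorem received_eq_none {x : Fin 3 → F → Bool} {t : ℕ} {v u : Fin n}
    (h : v ∉ G.active ∨ u ∉ G.active) : A.received (G.graph x) ω t v u = none := by
  unfold Algorithm.received
  rw [if_neg]
  rintro ⟨_, ⟨⟨j, f⟩, rfl⟩, hu, hv⟩
  exact h.elim (· (G.edge_subset _ _ _ hv)) (· (G.edge_subset _ _ _ hu))

/-- The messages that the given player receives within `T` rounds. -/
noncomputable def transcript (T : ℕ) (x : Fin 3 → F → Bool) :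
    Option (Fin n) → Fin T → G.active → Message B
  | none => fun _ _ => none
  | some v => fun t u => A.received (G.graph x) ω t v u

theorem stateAfter_congr {T : ℕ} {x x' : Fin 3 → F → Bool} {v : Fin n}
    (h : ∀ j ≠ G.playerMissing (G.player v), x j = x' j)
    (htr : G.transcript A ω T x (G.player v) = G.transcript A ω T x' (G.player v)) :
    A.stateAfter (G.graph x) ω T v = A.stateAfter (G.graph x') ω T v := by
  refine A.stateAfter_congr (G.incident_congr h) fun t ht u => ?_
  by_cases hv : v ∈ G.active
  · by_cases hu : u ∈ G.active
    · rw [player, if_pos hv] at htr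
      exact congrFun (congrFun htr ⟨t, ht⟩) ⟨u, hu⟩
    · rw [G.received_eq_none A ω (.inr hu), G.received_eq_none A ω (.inr hu)]
  · rw [G.received_eq_none A ω (.inl hv), G.received_eq_none A ω (.inl hv)]

variable [Fintype F]

open Classical in
/-- The indices of the edges of its missing type that occur in the output of the given player. -/
noncomputable def revealed (T : ℕ) (x : Fin 3 → F → Bool) (P : Option (Fin n)) : Finset F :=
  {f | ∃ v, G.player v = P ∧ ∃ t ∈ A.output (A.stateAfter (G.graph x) ω T v),
    ∃ j b, t.edge j = G.edge (G.playerMissing P) f b}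

variable {G A ω}

theorem mem_revealed {T : ℕ} {x : Fin 3 → F → Bool} {P : Option (Fin n)} {f : F} :
    f ∈ G.revealed A ω T x P ↔ ∃ v, G.player v = P ∧
      ∃ t ∈ A.output (A.stateAfter (G.graph x) ω T v),
        ∃ j b, t.edge j = G.edge (G.playerMissing P) f b := by
  simp [revealed]

theorem revealed_congr {T : ℕ} {x x' : Fin 3 → F → Bool} {P : Option (Fin n)}
    (h : ∀ j ≠ G.playerMissing P, x j = x' j)
    (htr : G.transcript A ω T x P = G.transcript A ω T x' P) :
    G.revealed A ω T x P = G.revealed A ω T x' P := by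
  ext f
  simp only [mem_revealed]
  refine exists_congr fun v => and_congr_right fun hv => ?_
  subst hv
  rw [G.stateAfter_congr A ω h htr]

/-- Equal views produce equal outputs. An output edge fixes both its index and its bit, and it must
be present in both hypergraphs. -/
theorem apply_eq_of_mem_revealed {κ : TriangleKind} {T : ℕ} {x x' : Fin 3 → F → Bool}
    {P : Option (Fin n)} (hx : A.Correct κ T (G.graph x) ω) (hx' : A.Correct κ T (G.graph x') ω)
    (h : ∀ j ≠ G.playerMissing P, x j = x' j)
    (htr : G.transcript A ω T x P = G.transcript A ω T x' P) {f : F}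
    (hf : f ∈ G.revealed A ω T x P) :
    x (G.playerMissing P) f = x' (G.playerMissing P) f := by
  obtain ⟨v, rfl, t, ht, j, b, hb⟩ := mem_revealed.1 hf
  have h₁ := (hx.1 v t ht).1.1 j
  rw [G.stateAfter_congr A ω h htr] at ht
  have h₂ := (hx'.1 v t ht).1.1 j
  rw [hb] at h₁ h₂
  rw [G.eq_of_edge_mem_graph h₁, G.eq_of_edge_mem_graph h₂]

theorem exists_mem_revealed {κ : TriangleKind} {T : ℕ} {x : Fin 3 → F → Bool}
    (hx : A.Correct κ T (G.graph x) ω) (g : Fin 3 → F) :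
    ∃ P ∈ G.active.insertNone, g (G.playerMissing P) ∈ G.revealed A ω T x P := by
  obtain ⟨v, ⟨t, ht, k, hk⟩, -⟩ := hx.2 _ (G.isTriangle_triangle κ x g)
  refine ⟨G.player v, G.player_mem v, mem_revealed.2 ⟨v, rfl, t, ht, ?_⟩⟩
  set i := G.playerMissing (G.player v)
  rcases hk with hk | hk
  -- The output may be a rotated or reversed copy; this is the position of the type `i` edge in it.
  · refine ⟨i - k, x i (g i), ?_⟩
    rw [(hk _).2, sub_add_cancel]
    rfl
  · refine ⟨k - i - 1, x i (g i), ?_⟩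
    rw [(hk _).2, (by decide : ∀ a b : Fin 3, a - (a - b - 1) - 1 = b) k i]
    rfl

/-- A revealed index accounts for only L² of the L³ choices `g`, and the players together must
account for all of them. -/
theorem exists_card_le_revealed [Nonempty F] {κ : TriangleKind} {T : ℕ} {x : Fin 3 → F → Bool}
    (hx : A.Correct κ T (G.graph x) ω) :
    ∃ P ∈ G.active.insertNone,
      Fintype.card F / (G.active.card + 1) ≤ (G.revealed A ω T x P).card := by
  classical
  by_contra! hcon
  set R := fun P => G.revealed A ω T x P
  set L := Fintype.card F
  have hL : 0 < L := Fintype.card_pos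
  have hcover : (Finset.univ : Finset (Fin 3 → F)) ⊆
      G.active.insertNone.biUnion fun P => Finset.univ.filter fun g => g (G.playerMissing P) ∈ R P := by
    intro g _
    obtain ⟨P, hP, hg⟩ := exists_mem_revealed hx g
    simp only [Finset.mem_biUnion, Finset.mem_filter, Finset.mem_univ, true_and]
    exact ⟨P, hP, hg⟩
  have hcard : ∀ (i : Fin 3) (S : Finset F),
      (Finset.univ.filter fun g : Fin 3 → F => g i ∈ S).card = S.card * L ^ 2 := by
    intro i S
    have : (Finset.univ.filter fun g : Fin 3 → F => g i ∈ S) =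
        Fintype.piFinset fun j => if j = i then S else Finset.univ := by
      ext g
      simp only [Finset.mem_filter, Finset.mem_univ, true_and, Fintype.mem_piFinset]
      refine ⟨fun h j => ?_, fun h => by simpa using h i⟩
      split_ifs with hj
      · exact hj ▸ h
      · exact Finset.mem_univ _
    rw [this, Fintype.card_piFinset, Fin.prod_univ_three]
    fin_cases i <;> simp [L] <;> ring
  have h₁ := (Finset.card_le_card hcover).trans Finset.card_biUnion_le
  simp only [hcard] at h₁
  have h₂ : ∑ P ∈ G.active.insertNone, (R P).card * L ^ 2
      < ∑ P ∈ G.active.insertNone, L / (G.active.card + 1) * L ^ 2 :=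
    Finset.sum_lt_sum_of_nonempty ⟨none, by simp⟩ fun P hP =>
      Nat.mul_lt_mul_of_pos_right (hcon P hP) (by positivity)
  rw [Finset.sum_const, Finset.card_insertNone, smul_eq_mul, ← mul_assoc] at h₂
  have h₃ := Nat.mul_div_le L (G.active.card + 1)
  have h₄ : Fintype.card (Fin 3 → F) = L * L ^ 2 := by simp [L]; ring
  rw [Finset.card_univ, h₄] at h₁
  have := Nat.mul_le_mul_right (L ^ 2) h₃
  omega

/-- Silence also carries information, at the cost of at most one extra bit. -/
theorem card_message (B : ℕ) : Fintype.card (Message B) ≤ 2 ^ (B + 1) := by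
  simp only [Message, Fintype.card_option, Fintype.card_pi, Fintype.card_bool, Finset.prod_const,
    Finset.card_univ, Fintype.card_fin, pow_succ]
  have := Nat.one_le_two_pow (n := B)
  omega

variable [DecidableEq F]

/-- An encoding argument: the transcript and the other two types determine the revealed bits, so
their places in the input are free to store an arbitrary subset of the revealed indices. -/
theorem card_mul_two_pow_le {κ : TriangleKind} {T : ℕ} (P : Option (Fin n)) (K : ℕ)
    (S : Finset (Fin 3 → F → Bool)) (hS : ∀ x ∈ S, A.Correct κ T (G.graph x) ω)
    (hK : ∀ x ∈ S, K ≤ (G.revealed A ω T x P).card) :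
    S.card * 2 ^ K ≤
      2 ^ (3 * Fintype.card F) * 2 ^ ((B + 1) * (G.active.card * T)) := by
  classical
  set i := G.playerMissing P with hi
  -- Flipping the bits in `y` stores `y`. Decoding recovers `x` first, since unrevealed bits are
  -- never flipped, and then `y` as the set of changed places.
  let flip : (Fin 3 → F → Bool) → Finset F → Fin 3 → F → Bool := fun x y j f =>
    if j = i ∧ f ∈ y then !x j f else x j f
  let U : Finset (Σ _ : Fin 3 → F → Bool, Finset F) :=
    S.sigma fun x => (G.revealed A ω T x P).powerset
  let φ : (Σ _ : Fin 3 → F → Bool, Finset F) →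
      (Fin 3 → F → Bool) × (Fin T → G.active → Message B) :=
    fun p => (flip p.1 p.2, G.transcript A ω T p.1 P)
  have hinj : Set.InjOn φ U := by
    rintro ⟨x, y⟩ hp ⟨x', y'⟩ hp' h
    simp only [U, Finset.coe_sigma, Set.mem_sigma_iff, Finset.mem_coe, Finset.mem_powerset]
      at hp hp'
    simp only [φ, Prod.mk.injEq] at h
    obtain ⟨hflip, htr⟩ := h
    have hoff : ∀ j ≠ G.playerMissing P, x j = x' j := fun j hj => by
      funext f
      have := congrFun (congrFun hflip j) f
      simpa [flip, show j ≠ i from hj] using this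
    have hR := revealed_congr hoff htr
    have hxx : x = x' := by
      funext j f
      by_cases hj : j = i
      · subst hj
        by_cases hf : f ∈ G.revealed A ω T x P
        · exact apply_eq_of_mem_revealed (hS x hp.1) (hS x' hp'.1) hoff htr hf
        · have h₁ : f ∉ y := fun h => hf (hp.2 h)
          have h₂ : f ∉ y' := fun h => hf (hR ▸ hp'.2 h)
          have := congrFun (congrFun hflip i) f
          simpa [flip, h₁, h₂] using this
      · exact congrFun (hoff j hj) f
    subst hxx
    have hyy : y = y' := by
      ext f
      have := congrFun (congrFun hflip i) f
      by_cases h₁ : f ∈ y <;> by_cases h₂ : f ∈ y' <;> simp_all [flip]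
    rw [hyy]
  have h₁ : S.card * 2 ^ K ≤ U.card := by
    rw [Finset.card_sigma, ← smul_eq_mul]
    refine Finset.card_nsmul_le_sum _ _ _ fun x hx => ?_
    rw [Finset.card_powerset]
    exact Nat.pow_le_pow_right (by norm_num) (hK x hx)
  have h₂ : U.card ≤ Fintype.card ((Fin 3 → F → Bool) × (Fin T → G.active → Message B)) := by
    rw [← Finset.card_image_of_injOn hinj]
    exact Finset.card_le_univ _
  have h₃ : Fintype.card (Fin T → G.active → Message B) ≤
      2 ^ ((B + 1) * (G.active.card * T)) := by
    rw [Fintype.card_fun, Fintype.card_fun, Fintype.card_coe, Fintype.card_fin, ← pow_mul, pow_mul 2]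
    exact Nat.pow_le_pow_left (card_message B) _
  have h₄ : Fintype.card (Fin 3 → F → Bool) = 2 ^ (3 * Fintype.card F) := by
    simp [← pow_mul, mul_comm]
  rw [Fintype.card_prod, h₄] at h₂
  exact h₁.trans (h₂.trans (Nat.mul_le_mul_left _ h₃))

theorem card_le_of_correct [Nonempty F] {κ : TriangleKind} {T : ℕ}
    (S : Finset (Fin 3 → F → Bool)) (hS : ∀ x ∈ S, A.Correct κ T (G.graph x) ω)
    (hcard : 2 ^ (3 * Fintype.card F) ≤ 2 * S.card) :
    Fintype.card F ≤ 2 * (G.active.card + 1) ^ 2 * (1 + (B + 1) * T) := by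
  classical
  set L := Fintype.card F
  set m := G.active.card with hm
  set K := L / (m + 1) with hK
  let S' : Option (Fin n) → Finset (Fin 3 → F → Bool) := fun P =>
    S.filter fun x => K ≤ (G.revealed A ω T x P).card
  have hcover : S ⊆ G.active.insertNone.biUnion S' := by
    intro x hx
    obtain ⟨P, hP, h⟩ := exists_card_le_revealed (hS x hx)
    exact Finset.mem_biUnion.2 ⟨P, hP, Finset.mem_filter.2 ⟨hx, h⟩⟩
  set M := 2 ^ (3 * L) * 2 ^ ((B + 1) * (m * T)) with hM
  have h₁ : S.card * 2 ^ K ≤ (m + 1) * M := by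
    calc S.card * 2 ^ K ≤ (∑ P ∈ G.active.insertNone, (S' P).card) * 2 ^ K :=
          Nat.mul_le_mul_right _ ((Finset.card_le_card hcover).trans Finset.card_biUnion_le)
      _ = ∑ P ∈ G.active.insertNone, (S' P).card * 2 ^ K := Finset.sum_mul _ _ _
      _ ≤ ∑ P ∈ G.active.insertNone, M := Finset.sum_le_sum fun P _ =>
          card_mul_two_pow_le P K (S' P) (fun x hx => hS x (Finset.mem_filter.1 hx).1)
            fun x hx => (Finset.mem_filter.1 hx).2
      _ = (m + 1) * M := by rw [Finset.sum_const, Finset.card_insertNone, smul_eq_mul]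
  have h₂ : 2 ^ (3 * L) * 2 ^ K ≤ 2 ^ (3 * L) * 2 ^ (m + 1 + (B + 1) * (m * T)) := by
    -- The union over players costs at most `m` bits, and restricting to half of the inputs costs
    -- one more.
    have : m + 1 ≤ 2 ^ m := Nat.lt_two_pow_self
    calc 2 ^ (3 * L) * 2 ^ K ≤ 2 * S.card * 2 ^ K := Nat.mul_le_mul_right _ hcard
      _ = 2 * (S.card * 2 ^ K) := by ring
      _ ≤ 2 * (2 ^ m * M) :=
          Nat.mul_le_mul_left _ (h₁.trans (Nat.mul_le_mul_right _ this))
      _ = _ := by rw [hM]; ring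
  have h₃ : K ≤ m + 1 + (B + 1) * (m * T) :=
    (Nat.pow_le_pow_iff_right (by norm_num : 1 < 2)).1
      (Nat.le_of_mul_le_mul_left h₂ (by positivity))
  have h₄ : L < (m + 1) * (K + 1) := Nat.lt_mul_div_succ L (by omega)
  nlinarith [Nat.zero_le ((B + 1) * T), Nat.zero_le m, Nat.zero_le (m * ((B + 1) * T)),
    Nat.zero_le (m * m * ((B + 1) * T)), Nat.mul_le_mul_left (m + 1) h₃]

end Counting

/-! ### Averaging over the random string -/

open MeasureTheory in
/-- An algorithm that is correct with probability at least `1 / 2` on all graphs of a gadget uses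
many rounds. -/
theorem card_le_of_solves {n B : ℕ} {F Ω : Type} [Fintype F] [DecidableEq F] [Nonempty F]
    (G : Gadget (Fin n) F) (A : Algorithm n B Ω) [MeasurableSpace Ω] (μ : Measure Ω)
    [IsProbabilityMeasure μ] {κ : TriangleKind} {C : ℝ} {T : ℕ}
    (hA : A.SolvesSparse μ κ C (1 / 2) T)
    (hsize : ∀ x, (totalSize (G.graph x) : ℝ) ≤ C * n) :
    Fintype.card F ≤ 2 * (G.active.card + 1) ^ 2 * (1 + (B + 1) * T) := by
  classical
  have hA' := fun x => hA (G.graph x) (G.isOn_graph x) (hsize x)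
  let E : (Fin 3 → F → Bool) → Set Ω := fun x => {ω | A.Correct κ T (G.graph x) ω}
  have hint : ∀ x, Integrable ((E x).indicator fun _ => (1 : ℝ)) μ := fun x =>
    (integrable_const _).indicator (hA' x).1
  -- Some string does at least as well as the expected number of correctly solved inputs.
  obtain ⟨ω, hω⟩ := exists_integral_le
    (integrable_finsetSum Finset.univ fun x (_ : x ∈ Finset.univ) => hint x)
  rw [integral_finsetSum _ fun x _ => hint x] at hω
  refine card_le_of_correct (G := G) (A := A) (ω := ω) (κ := κ)
    (Finset.univ.filter fun x => ω ∈ E x)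
    (fun x hx => (Finset.mem_filter.1 hx).2) ?_
  have h₁ : ∑ x, ((E x).indicator (fun _ => (1 : ℝ)) ω) =
      (Finset.univ.filter fun x => ω ∈ E x).card := by
    simp [Set.indicator_apply]
  have h₂ : (2 ^ (3 * Fintype.card F) : ℝ) * (1 / 2) ≤
      ∑ x, ∫ ω, (E x).indicator (fun _ => (1 : ℝ)) ω ∂μ := by
    have : ∑ _x : Fin 3 → F → Bool, (1 / 2 : ℝ) = (2 ^ (3 * Fintype.card F) : ℝ) * (1 / 2) := by
      simp [← pow_mul, mul_comm]
    rw [← this]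
    refine Finset.sum_le_sum fun x _ => ?_
    rw [integral_indicator_const _ (hA' x).1]
    simpa using (hA' x).2
  rw [h₁] at hω
  have h₃ := h₂.trans hω
  have h₄ : ((2 ^ (3 * Fintype.card F) : ℕ) : ℝ) ≤
      ((2 * (Finset.univ.filter fun x => ω ∈ E x).card : ℕ) : ℝ) := by
    push_cast
    linarith
  exact_mod_cast h₄

end Gadget

end HyperCongest

/-! ### Construction of the gadget -/

namespace HyperCongest

/-- The gadget in which the edges of each type are indexed by the functions `Fin s → Fin k`: such
an edge consists of two corners, one vertex for the selected bit, and the graph of its index. -/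
theorem exists_gadget {n s k : ℕ} (h : 9 + 3 * (s * k) ≤ n) :
    ∃ G : Gadget (Fin n) (Fin s → Fin k), G.active.card = 9 + 3 * (s * k) ∧
      ∀ i f b, (G.edge i f b).ncard ≤ s + 3 := by
  -- Three shared corners; each type also has its own two bit vertices and its own `s × k` grid for
  -- the graphs.
  let W := Fin 3 ⊕ Fin 3 × (Bool ⊕ Fin s × Fin k)
  have hW : Fintype.card W = 9 + 3 * (s * k) := by
    simp [W]
    ring
  obtain ⟨g⟩ := Function.Embedding.nonempty_of_card_le (α := W) (β := Fin n)
    (by rw [hW, Fintype.card_fin]; exact h)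
  let e : Fin 3 → (Fin s → Fin k) → Bool → Set W := fun i f b =>
    {.inl i, .inl (i + 1), .inr (i, .inl b)} ∪ Set.range fun j => .inr (i, .inr (j, f j))
  have he_inl : ∀ c i f b, (Sum.inl c : W) ∈ e i f b ↔ c = i ∨ c = i + 1 := by
    intro c i f b
    simp [e]
  have he_bit : ∀ c a i f b, (Sum.inr (c, .inl a) : W) ∈ e i f b ↔ c = i ∧ a = b := by
    intro c a i f b
    simp [e]
  have he_fun : ∀ c j y i f b,
      (Sum.inr (c, .inr (j, y)) : W) ∈ e i f b ↔ c = i ∧ f j = y := by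
    intro c j y i f b
    simp [e]
    tauto
  have hmem : ∀ w i f b, g w ∈ g '' e i f b ↔ w ∈ e i f b := fun w i f b =>
    g.injective.mem_set_image
  have hmiss : ∀ v : Fin n, ∃ i, ∀ f b, v ∉ g '' e i f b := by
    intro v
    by_cases hv : ∃ w, g w = v
    · obtain ⟨w, rfl⟩ := hv
      simp only [hmem]
      -- Corner `c` is only on types `c` and `c - 1`, any other vertex only on its own type `c`; so
      -- `c + 1` is always missing.
      rcases w with c | ⟨c, a | ⟨j, y⟩⟩
      · refine ⟨c + 1, fun f b => ?_⟩
        rw [he_inl]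
        omega
      · refine ⟨c + 1, fun f b => ?_⟩
        rw [he_bit]
        omega
      · refine ⟨c + 1, fun f b => ?_⟩
        rw [he_fun]
        omega
    · refine ⟨0, fun f b => ?_⟩
      rintro ⟨w, -, hw⟩
      exact hv ⟨w, hw⟩
  choose missing hmissing using hmiss
  refine ⟨{
    edge := fun i f b => g '' e i f b
    corner := fun i => g (.inl i)
    active := Finset.univ.map g
    missing := missing
    edge_inj := ?_
    corner_mem := fun i f b => by simp [hmem, he_inl]
    corner_mem_pred := fun i f b => by simp [hmem, he_inl]
    corner_notMem := fun i f b => by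
      rw [hmem, he_inl]
      omega
    edge_subset := fun i f b => by
      rintro _ ⟨w, -, rfl⟩
      simp
    notMem_edge_missing := hmissing }, ?_, ?_⟩
  · intro i f b i' f' b' heq
    have heq := g.injective.image_injective heq
    have h₁ := (he_bit i b i' f' b').1 (heq ▸ (he_bit i b i f b).2 ⟨rfl, rfl⟩)
    refine ⟨h₁.1, funext fun j => ?_, h₁.2⟩
    exact ((he_fun i j (f j) i' f' b').1 (heq ▸ (he_fun i j (f j) i f b).2 ⟨rfl, rfl⟩)).2.symm
  · rw [Finset.card_map, Finset.card_univ, hW]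
  · intro i f b
    refine (Set.ncard_image_le (Set.toFinite _)).trans ((Set.ncard_union_le _ _).trans ?_)
    have h₁ : ({.inl i, .inl (i + 1), .inr (i, .inl b)} : Set W).ncard ≤ 3 := by
      refine (Set.ncard_insert_le _ _).trans ?_
      refine Nat.succ_le_succ ((Set.ncard_insert_le _ _).trans ?_)
      rw [Set.ncard_singleton]
    have h₂ : (Set.range fun j : Fin s => (.inr (i, .inr (j, f j)) : W)).ncard ≤ s := by
      rw [← Set.image_univ]
      refine (Set.ncard_image_le (Set.toFinite _)).trans ?_
      simp [Set.ncard_univ]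
    omega

end HyperCongest

/-! ### Asymptotics and choice of parameters -/

namespace HyperCongest

open Filter in
theorem eventually_natCast_const_le_rpow (D : ℝ) {r : ℝ} (hr : 0 < r) :
    ∀ᶠ n : ℕ in atTop, D ≤ (n : ℝ) ^ r :=
  ((tendsto_rpow_atTop hr).comp tendsto_natCast_atTop_atTop).eventually_ge_atTop D

open Filter in
theorem eventually_natCast_log_le_rpow {β r : ℝ} (hβ : 0 < β) (hr : 0 < r) :
    ∀ᶠ n : ℕ in atTop, β * Real.log n + 1 ≤ (n : ℝ) ^ r := by
  have h₁ := tendsto_natCast_atTop_atTop.eventually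
    ((isLittleO_log_rpow_atTop hr).bound (show (0 : ℝ) < 1 / (2 * β) by positivity))
  filter_upwards [h₁, eventually_natCast_const_le_rpow 2 hr] with n h₁ h₂
  have h₃ := (le_abs_self _).trans h₁
  rw [Real.norm_of_nonneg (by positivity)] at h₃
  have h₄ := mul_le_mul_of_nonneg_left h₃ hβ.le
  have h₅ : β * (1 / (2 * β) * (n : ℝ) ^ r) = (n : ℝ) ^ r / 2 := by field_simp
  linarith

end HyperCongest

open HyperCongest Filter in
theorem theorem4p4 :
    ∃ p : ℝ, 0 < p ∧ p < 1 ∧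
      ∀ ε C β : ℝ, 0 < ε → 0 < C → 0 < β →
        ∃ c : ℝ, 0 < c ∧ ∃ n₀ : ℕ, ∀ n : ℕ, n₀ ≤ n →
          ∀ B : ℕ, (B : ℝ) ≤ β * Real.log n →
            ∀ (κ : HyperCongest.TriangleKind) (Ω : Type) [MeasurableSpace Ω]
              (μ : MeasureTheory.Measure Ω) [MeasureTheory.IsProbabilityMeasure μ]
              (A : HyperCongest.Algorithm n B Ω) (T : ℕ),
              A.SolvesSparse μ κ C p T → c * (n : ℝ) ^ (1 - ε) ≤ (T : ℝ) := by
  refine ⟨1 / 2, by norm_num, by norm_num, fun ε C β hε hC hβ => ?_⟩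
  -- The loss is n^(3δ): two factors n^δ from the squared number of players, one from `B + 1`. The
  -- cap at 1/4 keeps 1 - 2δ positive.
  set δ : ℝ := min ε 1 / 4 with hδ
  have hδ₀ : 0 < δ := by positivity
  have hδε : 3 * δ ≤ ε := by have := min_le_left ε 1; linarith
  have hδ₁ : δ ≤ 1 / 4 := by have := min_le_right ε 1; linarith
  obtain ⟨s, hs⟩ := exists_nat_ge (1 / δ)
  have hs₀ : (0 : ℝ) < s := lt_of_lt_of_le (by positivity) hs
  have hs₁ : s ≠ 0 := by rintro rfl; simp at hs₀
  have hsδ : 1 / (s : ℝ) ≤ δ := by rwa [one_div_le hs₀ hδ₀]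
  -- With at most `a * n` indices, three types and edges of size at most `s + 3`, the total size is
  -- at most `C * n`.
  set a : ℝ := C / (3 * (s + 3)) with ha
  have ha₀ : 0 < a := by positivity
  set a' : ℝ := a ^ (1 / (s : ℝ)) with ha'
  have ha'₀ : 0 < a' := by positivity
  set d : ℝ := 10 + 3 * s with hd
  have hd₀ : 0 < d := by positivity
  set D : ℝ := 2 ^ s / a * (2 * (d * a') ^ 2) with hD
  have hD₀ : 0 < D := by positivity
  refine ⟨1 / (2 * D), by positivity, eventually_atTop.1 ?_⟩
  filter_upwards [eventually_natCast_const_le_rpow (1 / a) one_pos,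
    eventually_natCast_const_le_rpow (d * a') (show 0 < 1 - δ by linarith),
    eventually_natCast_log_le_rpow hβ hδ₀,
    eventually_natCast_const_le_rpow (2 * D) (show 0 < 1 - 2 * δ by linarith),
    eventually_ge_atTop 1] with n h₁ h₂ h₃ h₄ hn B hB κ Ω _ μ _ A T hA
  have hn₁ : (1 : ℝ) ≤ n := by exact_mod_cast hn
  have hn₀ : (0 : ℝ) < n := by linarith
  rw [Real.rpow_one, div_le_iff₀ ha₀] at h₁
  set k : ℕ := ⌊(a * n) ^ (1 / (s : ℝ))⌋₊ with hk
  have hpow : ((a * n) ^ (1 / (s : ℝ))) ^ s = a * n := by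
    rw [one_div, Real.rpow_inv_natCast_pow (by positivity) hs₁]
  have hk_le : (k : ℝ) ≤ (a * n) ^ (1 / (s : ℝ)) := Nat.floor_le (by positivity)
  have hk_lt : (a * n) ^ (1 / (s : ℝ)) < k + 1 := Nat.lt_floor_add_one _
  have hk₁ : 1 ≤ k := by
    rw [hk, Nat.one_le_floor_iff]
    exact Real.one_le_rpow (by linarith) (by positivity)
  have hk₁' : (1 : ℝ) ≤ k := by exact_mod_cast hk₁
  have hks : (k : ℝ) ^ s ≤ a * n := by
    rw [← hpow]
    gcongr
  -- Rounding down costs at most a factor 2 in `k`, as `k + 1 ≤ 2 * k`.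
  have hks' : a * n ≤ 2 ^ s * (k : ℝ) ^ s := by
    rw [← hpow, ← mul_pow]
    gcongr
    linarith
  have hkδ : (k : ℝ) ≤ a' * (n : ℝ) ^ δ := by
    refine hk_le.trans ?_
    rw [Real.mul_rpow ha₀.le hn₀.le]
    gcongr
  have hm : (9 + 3 * (s * k) : ℝ) + 1 ≤ d * a' * (n : ℝ) ^ δ := by
    have : (9 + 3 * (s * k) : ℝ) + 1 ≤ d * k := by rw [hd]; linarith
    refine this.trans ?_
    rw [mul_assoc]
    gcongr
  have hmn : 9 + 3 * (s * k) ≤ n := by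
    have h₅ : d * a' * (n : ℝ) ^ δ ≤ n := by
      calc d * a' * (n : ℝ) ^ δ ≤ (n : ℝ) ^ (1 - δ) * (n : ℝ) ^ δ := by gcongr
        _ = n := by rw [← Real.rpow_add hn₀, sub_add_cancel, Real.rpow_one]
    have : ((9 + 3 * (s * k) : ℕ) : ℝ) ≤ n := by push_cast; linarith
    exact_mod_cast this
  obtain ⟨G, hG, hsize⟩ := exists_gadget hmn
  have : Nonempty (Fin s → Fin k) := ⟨fun _ => ⟨0, hk₁⟩⟩
  have hmain := G.card_le_of_solves A μ hA fun x => by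
    have h₅ := G.totalSize_graph x hsize
    have h₆ : (totalSize (G.graph x) : ℝ) ≤ 3 * (k : ℝ) ^ s * (s + 3) := by
      refine (Nat.cast_le.2 h₅).trans (le_of_eq ?_)
      simp
    refine h₆.trans ?_
    calc 3 * (k : ℝ) ^ s * (s + 3) ≤ 3 * (a * n) * (s + 3) := by gcongr
      _ = C * n := by rw [ha]; field_simp
  rw [hG] at hmain
  have hmain' : (k : ℝ) ^ s ≤ 2 * ((9 + 3 * (s * k) : ℝ) + 1) ^ 2 * (1 + (B + 1) * T) := by
    have := (Nat.cast_le (α := ℝ)).2 hmain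
    simpa using this
  have h₅ : (n : ℝ) ≤ D * ((n : ℝ) ^ δ) ^ 2 * (1 + (n : ℝ) ^ δ * T) := by
    calc (n : ℝ) = (a * n) / a := by field_simp
      _ ≤ 2 ^ s * (2 * (d * a' * (n : ℝ) ^ δ) ^ 2 * (1 + (n : ℝ) ^ δ * T)) / a := by
        refine div_le_div_of_nonneg_right (hks'.trans ?_) ha₀.le
        refine mul_le_mul_of_nonneg_left (hmain'.trans ?_) (by positivity)
        gcongr
        linarith
      _ = _ := by rw [hD]; ring
  set y : ℝ := (n : ℝ) ^ δ with hy
  have hy₀ : 0 < y := by positivity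
  have h₆ : (n : ℝ) = (n : ℝ) ^ (1 - 2 * δ) * y ^ 2 := by
    rw [hy, ← Real.rpow_natCast, ← Real.rpow_mul hn₀.le, ← Real.rpow_add hn₀]
    rw [show 1 - 2 * δ + δ * (2 : ℕ) = 1 by push_cast; ring, Real.rpow_one]
  have h₇ : (n : ℝ) ^ (1 - 2 * δ) ≤ D * (1 + y * T) := by
    have : (n : ℝ) ^ (1 - 2 * δ) * y ^ 2 ≤ D * (1 + y * T) * y ^ 2 := by
      rw [← h₆]
      linarith
    exact le_of_mul_le_mul_right this (by positivity)
  have h₈ : (n : ℝ) ^ (1 - 2 * δ) = (n : ℝ) ^ (1 - 3 * δ) * y := by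
    rw [hy, ← Real.rpow_add hn₀]
    congr 1
    ring
  have h₉ : (n : ℝ) ^ (1 - 3 * δ) ≤ 2 * D * T := by
    refine le_of_mul_le_mul_right ?_ hy₀
    rw [← h₈]
    -- By `h₄` the summand `D` in `h₇` is at most half of the left side and is absorbed.
    linarith
  calc 1 / (2 * D) * (n : ℝ) ^ (1 - ε) ≤ 1 / (2 * D) * (n : ℝ) ^ (1 - 3 * δ) := by
        gcongr
    _ ≤ 1 / (2 * D) * (2 * D * T) := by gcongr
    _ = T := by field_simp
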